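/- Call a space a $2$-dimensional $\mathbb{Q}$-vector subspace $V\subset\mathbb{C}$ that contains two $\mathbb{R}$-linearly independent vectors. Say that $V$ is CM (has complex multiplication) if there is $\lambda\in\mathbb{C}\setminus\mathbb{Q}$ with $\lambda V\subseteq V$. A rational angle of $V$ is an ordered pair of distinct lines $(\mathbb{R}v_1,\mathbb{R}v_2)$ with $v_1,v_2\in V\setminus\{0\}$ such that $v_2/v_1\notin\mathbb{R}$ and the argument of $v_2/v_1$ is a rational multiple of $\pi$. **Theorem.** Let \[ N_0=2^6\cdot 3^4\cdot 5^3\cdot\Bigl(\prod_{\substack{7\le p\le 37\\ p\text{ prime}}}p\Bigr)^2 . \] Every space that is not CM has only finitely many rational angles, and their number is at most $2N_0+4$. -/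

import Mathlib

/-- A *space*: a `ℚ`-subspace of `ℂ` of dimension two over `ℚ` that contains two
`ℝ`-linearly independent vectors. -/
def IsSpace (V : Submodule ℚ ℂ) : Prop :=
  Module.finrank ℚ V = 2 ∧ ∃ v ∈ V, ∃ w ∈ V, LinearIndependent ℝ ![v, w]

/-- A space *has complex multiplication* if multiplication by some `c ∈ ℂ \ ℚ` sends it to
itself. -/
def HasCM (V : Submodule ℚ ℂ) : Prop :=
  ∃ c : ℂ, c ∉ Set.range ((↑) : ℚ → ℂ) ∧ ∀ v ∈ V, c * v ∈ V

/-- Two nonzero complex numbers with non-real ratio *form a rational angle* if the argument of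
their ratio is a rational multiple of `π`. -/
def FormsRationalAngle (v₁ v₂ : ℂ) : Prop :=
  v₁ ≠ 0 ∧ v₂ ≠ 0 ∧ v₂ / v₁ ∉ Set.range ((↑) : ℝ → ℂ) ∧
    ∃ q : ℚ, Complex.arg (v₂ / v₁) = (q : ℝ) * Real.pi

/-- The set of rational angles of `V`: the ordered pairs of lines `(ℝ v₁, ℝ v₂)` where
`v₁, v₂ ∈ V` form a rational angle. (The lines `ℝ v₁` and `ℝ v₂` are distinct, since `v₂ / v₁`
is not real, and rescaling `v₁` or `v₂` by nonzero real numbers changes the argument of the ratio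
by a multiple of `π` only.) -/
def rationalAngles (V : Submodule ℚ ℂ) : Set (Submodule ℝ ℂ × Submodule ℝ ℂ) :=
  {L | ∃ v₁ ∈ V, ∃ v₂ ∈ V, FormsRationalAngle v₁ v₂ ∧
    L = (Submodule.span ℝ {v₁}, Submodule.span ℝ {v₂})}

/-- The constant `N₀ = 2⁶ · 3⁴ · 5³ · (∏_{7 ≤ p ≤ 37} p)²`, the product being over primes. -/
def N₀ : ℕ := 2 ^ 6 * 3 ^ 4 * 5 ^ 3 * (∏ p ∈ (Finset.Icc 7 37).filter Nat.Prime, p) ^ 2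

/-! A rational angle between `v` and `u` gives a root of unity `doubleAngle v u ≠ 1`, namely `exp
(2iβ)`, whose Cayley transform `i cot β` is a quotient of two bilinear expressions in the rational
coordinates of `v` and `u`. For a fixed space these transforms lie in a rational vector space of
dimension at most 3. It remains to bound the number of such roots of unity and the number of angles
sharing one of them.

For the first bound, three of the roots give transforms spanning the rest, so every other root `i`
occurs in a rational relation between at most four Cayley transforms. Clearing denominators gives a
vanishing sum of at most `2 ^ 4 = 16` monomials in the roots. By a form of Mann's theorem
(`sum_filter_pow_primorial_eq_one`) it splits into vanishing subsums, one per value of the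
`primorial 16`-th power, so it survives each deformation `j ↦ j * t ^ m j` whose total exponent is
constant on these classes. Dirichlet approximation either bounds the order of `i` or yields such an
`m` with small entries and `m i ≠ 0`. Choosing `t` so that `i` moves to `1`, a pole of the Cayley
transform, forces another root `l` to move to `1` too, hence a relation `i ^ m = l ^ m'` of bounded
height (`bounded_order_or_bounded_relation`). Only boundedly many `i` satisfy one of the two.

For the second, three angles with the same double angle force complex multiplication
(`hasCM_of_three_rotations`), so each root of unity serves at most two angles. -/

/-! ### Vanishing sums of roots of unity. -/

/-- A vanishing rational combination of `n`-th roots of unity stays zero when all the roots are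
raised to a power prime to `n`. -/
theorem sum_mul_pow_eq_zero_of_coprime {ι : Type*} (s : Finset ι) (a : ι → ℚ) (z : ι → ℂ)
    {n : ℕ} (hn : 0 < n) (hz : ∀ i ∈ s, z i ^ n = 1) (h : ∑ i ∈ s, (a i : ℂ) * z i = 0)
    {g : ℕ} (hg : g.Coprime n) : ∑ i ∈ s, (a i : ℂ) * z i ^ g = 0 := by
  have hζ := Complex.isPrimitiveRoot_exp n hn.ne'
  set ζ := Complex.exp (2 * Real.pi * Complex.I / n) with hζdef
  have : NeZero n := ⟨hn.ne'⟩
  have hex : ∀ i, ∃ e : ℕ, i ∈ s → ζ ^ e = z i := by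
    intro i
    by_cases hi : i ∈ s
    · obtain ⟨e, -, he⟩ := hζ.eq_pow_of_pow_eq_one (hz i hi)
      exact ⟨e, fun _ => he⟩
    · exact ⟨0, fun h => absurd h hi⟩
  choose e he using hex
  let P : Polynomial ℚ := ∑ i ∈ s, Polynomial.C (a i) * Polynomial.X ^ e i
  have hP : ∀ x : ℂ, Polynomial.aeval x P = ∑ i ∈ s, (a i : ℂ) * x ^ e i := by
    intro x
    simp [P, map_sum]
  have h0 : Polynomial.aeval ζ P = 0 := by
    rw [hP, ← h]
    exact Finset.sum_congr rfl fun i hi => by rw [he i hi]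
  have hdvd : minpoly ℚ ζ ∣ P := minpoly.dvd ℚ ζ h0
  have hmin : minpoly ℚ ζ = minpoly ℚ (ζ ^ g) := by
    rw [← Polynomial.cyclotomic_eq_minpoly_rat hζ hn,
      ← Polynomial.cyclotomic_eq_minpoly_rat (hζ.pow_of_coprime g hg) hn]
  have h1 : Polynomial.aeval (ζ ^ g) P = 0 := by
    obtain ⟨Q, hQ⟩ := hdvd
    rw [hQ, hmin, map_mul, minpoly.aeval, zero_mul]
  rw [hP] at h1
  rw [← h1]
  refine Finset.sum_congr rfl fun i hi => ?_
  rw [← he i hi, ← pow_mul, ← pow_mul, mul_comm g]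

/-- In a vanishing rational combination of `p * d`-th roots of unity, the terms that are `d`-th
roots of unity have sum zero, if `p ∣ d` or there are fewer than `p` terms. -/
theorem sum_filter_pow_eq_one_eq_zero {ι : Type*} (s : Finset ι) (a : ι → ℚ) (z : ι → ℂ)
    {p d : ℕ} (hp : p.Prime) (hd : 0 < d) (hpd : p ∣ d ∨ s.card < p)
    (hz : ∀ i ∈ s, z i ^ (p * d) = 1) (h : ∑ i ∈ s, (a i : ℂ) * z i = 0) :
    ∑ i ∈ s with z i ^ d = 1, (a i : ℂ) * z i = 0 := by
  have hp0 : (p : ℂ) ≠ 0 := by exact_mod_cast hp.ne_zero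
  have hpd0 : 0 < p * d := Nat.mul_pos hp.pos hd
  have hcop : ∀ j, ¬ p ∣ 1 + j * d → ∑ i ∈ s, (a i : ℂ) * z i ^ (1 + j * d) = 0 := by
    intro j hj
    refine sum_mul_pow_eq_zero_of_coprime s a z hpd0 hz h ?_
    refine Nat.Coprime.mul_right ?_ ?_
    · exact ((Nat.Prime.coprime_iff_not_dvd hp).2 hj).symm
    · simp
  -- Fourier inversion on the `p`-th roots of unity `z i ^ d`: the exponents `1 + j * d` leave
  -- `d`-th roots of unity fixed and are prime to `d`.
  have hfourier : ∀ χ : ℂ, χ ^ p = 1 →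
      (p : ℂ) * ∑ i ∈ s with z i ^ d = χ, (a i : ℂ) * z i =
        ∑ j ∈ Finset.range p, χ⁻¹ ^ j * ∑ i ∈ s, (a i : ℂ) * z i ^ (1 + j * d) := by
    intro χ hχ
    have hχ0 : χ ≠ 0 := by
      rintro rfl
      simp [hp.ne_zero] at hχ
    simp_rw [Finset.mul_sum]
    rw [Finset.sum_comm, Finset.sum_filter]
    refine Finset.sum_congr rfl fun i hi => ?_
    have hterm : ∀ j, χ⁻¹ ^ j * ((a i : ℂ) * z i ^ (1 + j * d)) =
        (a i : ℂ) * z i * (χ⁻¹ * z i ^ d) ^ j := by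
      intro j
      rw [mul_pow, ← pow_mul, pow_add, pow_one, mul_comm j d]
      ring
    simp_rw [hterm]
    rw [← Finset.mul_sum]
    split_ifs with hc
    · rw [hc, inv_mul_cancel₀ hχ0]
      simp [mul_comm]
    · have hne : χ⁻¹ * z i ^ d ≠ 1 := by
        intro h1
        apply hc
        field_simp at h1
        exact h1
      rw [geom_sum_eq hne, mul_pow, inv_pow, hχ, ← pow_mul, mul_comm d p, hz i hi]
      simp
  rcases em (p ∣ d) with hdvd | hnd
  · have := hfourier 1 (one_pow p)
    rw [Finset.sum_eq_zero (s := Finset.range p)] at this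
    · exact (mul_eq_zero.1 this).resolve_left hp0
    · intro j _
      rw [hcop j, mul_zero]
      intro hj
      have : p ∣ 1 := (Nat.dvd_add_left (hdvd.mul_left j)).1 hj
      exact hp.one_lt.ne' (Nat.dvd_one.1 this)
  · have hcard : s.card < p := hpd.resolve_left hnd
    have hcd : Nat.Coprime d p := ((Nat.Prime.coprime_iff_not_dvd hp).2 hnd).symm
    -- As `d` is invertible mod `p`, at most one exponent fails to be prime to `p`; its power sum
    -- `T` is the only one that may be nonzero.
    have hex : ∃ j0, ∀ j < p, j ≠ j0 → ¬ p ∣ 1 + j * d := by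
      by_cases hall : ∃ j0 < p, p ∣ 1 + j0 * d
      · obtain ⟨j0, hj0, hdv⟩ := hall
        refine ⟨j0, fun j hj hne hdj => hne ?_⟩
        have h1 : 1 + j * d ≡ 1 + j0 * d [MOD p] :=
          ((Nat.modEq_zero_iff_dvd).2 hdj).trans ((Nat.modEq_zero_iff_dvd).2 hdv).symm
        have h2 : j * d ≡ j0 * d [MOD p] := Nat.ModEq.add_left_cancel' 1 h1
        have h3 : j ≡ j0 [MOD p] := Nat.ModEq.cancel_right_of_coprime
          (by rw [Nat.gcd_comm]; exact hcd) h2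
        exact Nat.ModEq.eq_of_lt_of_lt h3 hj hj0
      · exact ⟨0, fun j hj _ hdj => hall ⟨j, hj, hdj⟩⟩
    obtain ⟨j0, hj0⟩ := hex
    set T := ∑ i ∈ s, (a i : ℂ) * z i ^ (1 + j0 * d) with hT
    have hsing : ∀ χ : ℂ, χ ^ p = 1 →
        (p : ℂ) * ∑ i ∈ s with z i ^ d = χ, (a i : ℂ) * z i =
          if j0 < p then χ⁻¹ ^ j0 * T else 0 := by
      intro χ hχ
      rw [hfourier χ hχ]
      split_ifs with hlt
      · rw [Finset.sum_eq_single j0]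
        · intro j hj hne
          rw [hcop j (hj0 j (Finset.mem_range.1 hj) hne), mul_zero]
        · intro hn
          exact absurd (Finset.mem_range.2 hlt) hn
      · refine Finset.sum_eq_zero fun j hj => ?_
        have hj' := Finset.mem_range.1 hj
        rw [hcop j (hj0 j hj' (by omega)), mul_zero]
    -- Fewer than `p` terms leave some class `χ` empty; its sum is `0`, yet it is a nonzero multiple
    -- of `T`.
    have hT0 : j0 < p → T = 0 := by
      intro hlt
      have hζ := Complex.isPrimitiveRoot_exp p hp.ne_zero
      have hroots : (Polynomial.nthRootsFinset p (1 : ℂ)).card = p := hζ.card_nthRootsFinset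
      obtain ⟨χ, hχ, hχs⟩ := Finset.exists_mem_notMem_of_card_lt_card
        (s := s.image fun i => z i ^ d) (t := Polynomial.nthRootsFinset p (1 : ℂ))
        (by rw [hroots]; exact Finset.card_image_le.trans_lt hcard)
      have hχ1 : χ ^ p = 1 := (Polynomial.mem_nthRootsFinset hp.pos 1).1 hχ
      have hχ0 : χ ≠ 0 := by
        rintro rfl
        simp [hp.ne_zero] at hχ1
      have h1 := hsing χ hχ1
      rw [if_pos hlt, Finset.sum_filter, Finset.sum_eq_zero, mul_zero] at h1
      · exact (mul_eq_zero.1 h1.symm).resolve_left (pow_ne_zero _ (inv_ne_zero hχ0))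
      · intro i hi
        rw [if_neg]
        intro hc
        exact hχs (Finset.mem_image.2 ⟨i, hi, hc⟩)
    have h1 := hsing 1 (one_pow p)
    have h2 : (if j0 < p then (1 : ℂ)⁻¹ ^ j0 * T else 0) = 0 := by
      split_ifs with hlt
      · rw [hT0 hlt, mul_zero]
      · rfl
    rw [h2] at h1
    exact (mul_eq_zero.1 h1).resolve_left hp0

/-- A form of Mann's theorem: in a vanishing rational combination of at most `k` roots of unity,
those whose order divides the product of the primes up to `k` have sum zero. -/
theorem sum_filter_pow_primorial_eq_one {ι : Type*} (k : ℕ) (a : ι → ℚ) (z : ι → ℂ) (n : ℕ) :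
    ∀ s : Finset ι, 0 < n → s.card ≤ k → (∀ i ∈ s, z i ^ n = 1) →
      ∑ i ∈ s, (a i : ℂ) * z i = 0 →
      ∑ i ∈ s with z i ^ primorial k = 1, (a i : ℂ) * z i = 0 := by
  induction n using Nat.strong_induction_on with
  | _ n ih =>
    intro s hn hs hz h
    by_cases hdvd : n ∣ primorial k
    · rw [Finset.filter_true_of_mem]
      · exact h
      · intro i hi
        obtain ⟨c, hc⟩ := hdvd
        rw [hc, pow_mul, hz i hi, one_pow]
    -- Either `n` has a prime factor `p > k`, or a repeated one. The gcd condition ensures that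
    -- passing to `d`-th roots of unity loses no term of order dividing `primorial k`.
    · obtain ⟨p, d, hp, hnpd, hpd, hgcd⟩ : ∃ p d : ℕ, p.Prime ∧ n = p * d ∧
          (p ∣ d ∨ s.card < p) ∧ Nat.gcd (primorial k) n ∣ d := by
        have hsqM : Squarefree (primorial k) := by
          unfold primorial
          refine Finset.squarefree_prod_of_pairwise_isCoprime ?_ ?_
          · intro x hx y hy hxy
            have hx' := (Finset.mem_filter.1 hx).2
            have hy' := (Finset.mem_filter.1 hy).2
            exact Nat.coprime_iff_isRelPrime.1 ((Nat.coprime_primes hx' hy').2 hxy)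
          · intro x hx
            exact (Finset.mem_filter.1 hx).2.prime.squarefree
        by_cases hsq : Squarefree n
        · obtain ⟨p, hp, hpn, hpk⟩ : ∃ p, p.Prime ∧ p ∣ n ∧ k < p := by
            by_contra hcon
            push Not at hcon
            apply hdvd
            rw [← Nat.prod_primeFactors_of_squarefree hsq]
            unfold primorial
            refine Finset.prod_dvd_prod_of_subset _ _ _ ?_
            intro q hq
            have hq' := Nat.mem_primeFactors.1 hq
            have := hcon q hq'.1 hq'.2.1
            exact Finset.mem_filter.2 ⟨Finset.mem_range.2 (by omega), hq'.1⟩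
          obtain ⟨d, rfl⟩ := hpn
          refine ⟨p, d, hp, rfl, Or.inr (by omega), ?_⟩
          have hcop : Nat.Coprime (primorial k) p := by
            rw [Nat.coprime_comm, Nat.Prime.coprime_iff_not_dvd hp]
            intro hpM
            exact absurd (hp.dvd_primorial_iff.1 hpM) (by omega)
          exact (hcop.coprime_dvd_left (Nat.gcd_dvd_left _ _)).dvd_of_dvd_mul_left
            (Nat.gcd_dvd_right _ _)
        · rw [Nat.squarefree_iff_prime_squarefree] at hsq
          push Not at hsq
          obtain ⟨p, hp, e, he⟩ := hsq
          refine ⟨p, p * e, hp, by rw [he, mul_assoc], Or.inl (dvd_mul_right _ _), ?_⟩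
          have hG : Squarefree (Nat.gcd (primorial k) n) :=
            hsqM.squarefree_of_dvd (Nat.gcd_dvd_left _ _)
          set G := Nat.gcd (primorial k) n with hGdef
          have hGn : G ∣ p * (p * e) := by
            rw [← mul_assoc, ← he]
            exact Nat.gcd_dvd_right _ _
          by_cases hpG : p ∣ G
          · obtain ⟨f, hf⟩ := hpG
            rw [hf] at hGn hG ⊢
            have hfe : f ∣ p * e := Nat.dvd_of_mul_dvd_mul_left hp.pos hGn
            have hcf : Nat.Coprime f p := by
              rw [Nat.coprime_comm]
              exact Nat.coprime_of_squarefree_mul hG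
            exact Nat.mul_dvd_mul_left p (hcf.dvd_of_dvd_mul_left hfe)
          · have : Nat.Coprime G p := ((Nat.Prime.coprime_iff_not_dvd hp).2 hpG).symm
            exact this.dvd_of_dvd_mul_left hGn
      subst hnpd
      have hd : 0 < d := Nat.pos_of_mul_pos_left hn
      have h1 := sum_filter_pow_eq_one_eq_zero s a z hp hd hpd hz h
      have h2 := ih d (by nlinarith [hp.two_le]) (s.filter fun i => z i ^ d = 1) hd
        ((Finset.card_filter_le _ _).trans hs) (fun i hi => (Finset.mem_filter.1 hi).2) h1
      rw [← h2, Finset.filter_filter]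
      refine Finset.sum_congr (Finset.filter_congr fun i hi => ?_) fun _ _ => rfl
      refine ⟨fun hM => ⟨?_, hM⟩, fun hM => hM.2⟩
      obtain ⟨c, hc⟩ := hgcd
      have : z i ^ Nat.gcd (primorial k) (p * d) = 1 := pow_gcd_eq_one.2 ⟨hM, hz i hi⟩
      rw [hc, pow_mul, this, one_pow]

/-! ### Diophantine approximation. -/

/-- Simultaneous Dirichlet approximation with error less than `1 / 5`. -/
theorem exists_nat_forall_abs_mul_sub_round_lt {α : Type*} (T : Finset α) (y : α → ℝ) :
    ∃ q : ℕ, 1 ≤ q ∧ q ≤ 5 ^ T.card ∧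
      ∀ x ∈ T, |(q : ℝ) * y x - round ((q : ℝ) * y x)| < 1 / 5 := by
  classical
  -- Pigeonhole: `5 ^ T.card + 1` multipliers fall into `5 ^ T.card` boxes of side `1 / 5`.
  let f : ℕ → (T → Fin 5) := fun q x =>
    ⟨⌊5 * Int.fract ((q : ℝ) * y x)⌋₊, by
      have h1 := Int.fract_lt_one ((q : ℝ) * y x)
      have h0 := Int.fract_nonneg ((q : ℝ) * y x)
      rw [Nat.floor_lt (by positivity)]
      push_cast
      linarith⟩
  have hcard : (Finset.univ : Finset (T → Fin 5)).card < (Finset.range (5 ^ T.card + 1)).card := by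
    simp
  obtain ⟨q₁, hq₁, q₂, hq₂, hne, heq⟩ := Finset.exists_ne_map_eq_of_card_lt_of_maps_to hcard
    (f := f) (fun q _ => Finset.mem_coe.2 (Finset.mem_univ _))
  wlog hlt : q₁ < q₂ generalizing q₁ q₂
  · exact this q₂ hq₂ q₁ hq₁ hne.symm heq.symm (by omega)
  rw [Finset.mem_range] at hq₁ hq₂
  refine ⟨q₂ - q₁, by omega, by omega, fun x hx => ?_⟩
  have hx' := congrArg Fin.val (congrFun heq ⟨x, hx⟩)
  simp only [f] at hx'
  have key : |Int.fract ((q₁ : ℝ) * y x) - Int.fract ((q₂ : ℝ) * y x)| < 1 / 5 := by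
    have a1 := Nat.floor_le (a := 5 * Int.fract ((q₁ : ℝ) * y x))
      (by have := Int.fract_nonneg ((q₁ : ℝ) * y x); positivity)
    have a2 := Nat.lt_floor_add_one (5 * Int.fract ((q₁ : ℝ) * y x))
    have b1 := Nat.floor_le (a := 5 * Int.fract ((q₂ : ℝ) * y x))
      (by have := Int.fract_nonneg ((q₂ : ℝ) * y x); positivity)
    have b2 := Nat.lt_floor_add_one (5 * Int.fract ((q₂ : ℝ) * y x))
    rw [hx'] at a1 a2
    rw [abs_lt]
    constructor <;> linarith
  refine (round_le _ (⌊(q₂ : ℝ) * y x⌋ - ⌊(q₁ : ℝ) * y x⌋)).trans_lt ?_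
  rw [abs_sub_comm] at key
  refine lt_of_eq_of_lt (congrArg _ ?_) key
  rw [Nat.cast_sub hlt.le, Int.fract, Int.fract]
  push_cast
  ring

/-- Since `4 / 5 < 1`, an integer that equals such a sum is zero; this is why the error `1 / 5`
suits four variables. -/
theorem abs_sum_mul_lt_one {α : Type*} (T : Finset α) (hT : T.card ≤ 4) (v δ : α → ℝ)
    (hv : ∀ x ∈ T, |v x| ≤ 1) (hδ : ∀ x ∈ T, |δ x| < 1 / 5) : |∑ x ∈ T, v x * δ x| < 1 := by
  have h1 : |∑ x ∈ T, v x * δ x| ≤ ∑ x ∈ T, (1 / 5 : ℝ) := by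
    refine (Finset.abs_sum_le_sum_abs _ _).trans (Finset.sum_le_sum fun x hx => ?_)
    rw [abs_mul]
    have := hv x hx
    have := hδ x hx
    have := abs_nonneg (δ x)
    nlinarith [abs_nonneg (v x)]
  rw [Finset.sum_const, nsmul_eq_mul] at h1
  have : (T.card : ℝ) ≤ 4 := by exact_mod_cast hT
  linarith

/-- If a real vector with nonzero `i`-th coordinate is orthogonal to a set of vectors with entries
of absolute value at most `1`, then so is an integer vector with bounded entries. -/
theorem exists_int_orthogonal_of_real {α : Type*} (T : Finset α) (hT : T.card ≤ 4)
    (L : Set (α → ℤ)) (hL : ∀ v ∈ L, ∀ x ∈ T, |v x| ≤ 1) {i : α} (hi : i ∈ T) (k : ℕ) :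
    ∀ ε : α → ℝ, (∀ x ∈ T, |ε x| ≤ 1) → 1 ≤ 5 ^ k * |ε i| →
      (∀ v ∈ L, ∑ x ∈ T, (v x : ℝ) * ε x = 0) →
      ∃ m : α → ℤ, m i ≠ 0 ∧ (∀ x ∈ T, |m x| ≤ 625) ∧ ∀ v ∈ L, ∑ x ∈ T, v x * m x = 0 := by
  have step : ∀ ε : α → ℝ, (∀ x ∈ T, |ε x| ≤ 1) →
      (∀ v ∈ L, ∑ x ∈ T, (v x : ℝ) * ε x = 0) →
      ∃ (q : ℕ) (m : α → ℤ), 1 ≤ q ∧ (∀ x ∈ T, |m x| ≤ 625) ∧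
        (∀ x ∈ T, |(q : ℝ) * ε x - m x| < 1 / 5) ∧ ∀ v ∈ L, ∑ x ∈ T, v x * m x = 0 := by
    intro ε hε horth
    obtain ⟨q, hq1, hq, hr⟩ := exists_nat_forall_abs_mul_sub_round_lt T ε
    have hq625 : (q : ℝ) ≤ 625 := by
      have : q ≤ 5 ^ 4 := hq.trans (Nat.pow_le_pow_right (by norm_num) hT)
      exact_mod_cast this
    refine ⟨q, fun x => round ((q : ℝ) * ε x), hq1, fun x hx => ?_, hr, fun v hv => ?_⟩
    · have h1 := hr x hx
      have h2 : |(q : ℝ) * ε x| ≤ 625 := by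
        rw [abs_mul, Nat.abs_cast]
        have := hε x hx
        have h0 := abs_nonneg (ε x)
        nlinarith
      have h3 : |((round ((q : ℝ) * ε x) : ℤ) : ℝ)| < 626 := by
        rw [abs_lt] at h1 ⊢
        rw [abs_le] at h2
        constructor <;> linarith
      have h4 : |round ((q : ℝ) * ε x)| < 626 := by exact_mod_cast h3
      exact Int.lt_add_one_iff.1 h4
    · have h1 : |((∑ x ∈ T, v x * round ((q : ℝ) * ε x) : ℤ) : ℝ)| < 1 := by
        have h2 : ((∑ x ∈ T, v x * round ((q : ℝ) * ε x) : ℤ) : ℝ) =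
            -∑ x ∈ T, (v x : ℝ) * ((q : ℝ) * ε x - round ((q : ℝ) * ε x)) := by
          have h3 : ∑ x ∈ T, (v x : ℝ) * ((q : ℝ) * ε x - round ((q : ℝ) * ε x)) =
              q * ∑ x ∈ T, (v x : ℝ) * ε x -
                ∑ x ∈ T, (v x : ℝ) * round ((q : ℝ) * ε x) := by
            rw [Finset.mul_sum, ← Finset.sum_sub_distrib]
            exact Finset.sum_congr rfl fun x _ => by ring
          rw [h3, horth v hv]
          push_cast
          ring
        rw [h2, abs_neg]
        exact abs_sum_mul_lt_one T hT _ _ (fun x hx => by exact_mod_cast hL v hv x hx) hr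
      have h4 : |∑ x ∈ T, v x * round ((q : ℝ) * ε x)| < 1 := by exact_mod_cast h1
      exact Int.abs_lt_one_iff.1 h4
  induction k with
  | zero =>
    intro ε hε hεi horth
    obtain ⟨q, m, hq1, hm, hr, hmL⟩ := step ε hε horth
    refine ⟨m, fun h0 => ?_, hm, hmL⟩
    have h1 := hr i hi
    have h2 : (1 : ℝ) ≤ q := by exact_mod_cast hq1
    rw [h0, Int.cast_zero, sub_zero, abs_mul, Nat.abs_cast] at h1
    rw [pow_zero, one_mul] at hεi
    nlinarith
  | succ k ih =>
    intro ε hε hεi horth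
    obtain ⟨q, m, hq1, hm, hr, hmL⟩ := step ε hε horth
    by_cases h0 : m i = 0
    -- The rescaled error is still orthogonal to `L` with entries at most `1`, and as `m i = 0` its
    -- `i`-th entry has grown by a factor of at least `5`.
    · refine ih (fun x => 5 * (q * ε x - m x)) (fun x hx => ?_) ?_ fun v hv => ?_
      · rw [abs_mul, abs_of_pos (by norm_num : (0 : ℝ) < 5)]
        linarith [hr x hx]
      · have h2 : (1 : ℝ) ≤ q := by exact_mod_cast hq1
        rw [h0, Int.cast_zero, sub_zero, abs_mul, abs_mul, Nat.abs_cast,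
          abs_of_pos (by norm_num : (0 : ℝ) < 5)]
        calc (1 : ℝ) ≤ 5 ^ (k + 1) * |ε i| := hεi
          _ ≤ q * (5 ^ (k + 1) * |ε i|) := le_mul_of_one_le_left (by positivity) h2
          _ = _ := by ring
      · have h3 : ∑ x ∈ T, (v x : ℝ) * (5 * (q * ε x - m x)) =
            5 * (q * ∑ x ∈ T, (v x : ℝ) * ε x - ((∑ x ∈ T, v x * m x : ℤ) : ℝ)) := by
          push_cast
          rw [Finset.mul_sum, ← Finset.sum_sub_distrib, Finset.mul_sum]
          exact Finset.sum_congr rfl fun x _ => by ring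
        rw [h3, horth v hv, hmL v hv]
        simp
    · exact ⟨m, h0, hm, hmL⟩

/-! ### Deforming relations between Cayley transforms. -/

/-- The Cayley transform; it maps `exp (2 i β)` to `i cot β`. -/
noncomputable def cayley (z : ℂ) : ℂ := (1 + z) / (1 - z)

/-- The numerator of a combination of Cayley transforms is a combination of square-free
monomials. -/
theorem exists_cayley_numerator_expansion (T : Finset ℂ) (c : ℂ → ℚ) :
    ∃ a : Finset ℂ → ℚ, ∀ x : ℂ → ℂ,
      ∑ j ∈ T, (c j : ℂ) * ((1 + x j) * ∏ l ∈ T.erase j, (1 - x l)) =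
        ∑ S ∈ T.powerset, (a S : ℂ) * ∏ l ∈ S, x l := by
  classical
  -- The `j`-th summand is a product of factors `1 ± x l` with sign `+` only at `l = j`; the signs
  -- multiply to the coefficient.
  refine ⟨fun S => ∑ j ∈ T, c j * ∏ l ∈ S, if l = j then 1 else -1, fun x => ?_⟩
  have h1 : ∀ j ∈ T, (1 + x j) * ∏ l ∈ T.erase j, (1 - x l) =
      ∑ S ∈ T.powerset, (∏ l ∈ S, if l = j then (1 : ℂ) else -1) * ∏ l ∈ S, x l := by
    intro j hj
    have h2 : (1 + x j) * ∏ l ∈ T.erase j, (1 - x l) =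
        ∏ l ∈ T, (1 + (if l = j then (1 : ℂ) else -1) * x l) := by
      rw [← Finset.mul_prod_erase T _ hj, if_pos rfl, one_mul]
      congr 1
      refine Finset.prod_congr rfl fun l hl => ?_
      rw [if_neg (Finset.ne_of_mem_erase hl)]
      ring
    rw [h2, Finset.prod_one_add]
    exact Finset.sum_congr rfl fun S _ => Finset.prod_mul_distrib
  rw [Finset.sum_congr rfl fun j hj => by rw [h1 j hj]]
  simp_rw [Finset.mul_sum]
  rw [Finset.sum_comm]
  refine Finset.sum_congr rfl fun S _ => ?_
  rw [Rat.cast_sum, Finset.sum_mul]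
  refine Finset.sum_congr rfl fun j _ => ?_
  rw [Rat.cast_mul, Rat.cast_prod, mul_assoc]
  congr 3
  funext l
  split_ifs <;> simp

theorem cayley_numerator_eq (T : Finset ℂ) (c : ℂ → ℚ) (x : ℂ → ℂ) (hx : ∀ j ∈ T, x j ≠ 1) :
    ∑ j ∈ T, (c j : ℂ) * ((1 + x j) * ∏ l ∈ T.erase j, (1 - x l)) =
      (∏ l ∈ T, (1 - x l)) * ∑ j ∈ T, (c j : ℂ) * cayley (x j) := by
  rw [Finset.mul_sum]
  refine Finset.sum_congr rfl fun j hj => ?_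
  have : 1 - x j ≠ 0 := sub_ne_zero.2 (hx j hj).symm
  rw [← Finset.mul_prod_erase T _ hj, cayley]
  field_simp

/-- Vanishing sums of roots of unity can be deformed along exponents that are constant on the
classes of terms whose ratio has order dividing the primorial. -/
theorem sum_mul_zpow_eq_zero {ι : Type*} (k : ℕ) (I : Finset ι) (hI : I.card ≤ k) (a : ι → ℚ)
    (z : ι → ℂ) {n : ℕ} (hn : 0 < n) (hz : ∀ i ∈ I, z i ^ n = 1)
    (h : ∑ i ∈ I, (a i : ℂ) * z i = 0) (e : ι → ℤ)
    (he : ∀ i ∈ I, ∀ j ∈ I, z i ^ primorial k = z j ^ primorial k → e i = e j) (t : ℂ) :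
    ∑ i ∈ I, (a i : ℂ) * (z i * t ^ e i) = 0 := by
  classical
  rw [← Finset.sum_fiberwise_of_maps_to
    (fun i hi => Finset.mem_image_of_mem (fun i => z i ^ primorial k) hi)]
  refine Finset.sum_eq_zero fun b hb => ?_
  obtain ⟨i₀, hi₀, rfl⟩ := Finset.mem_image.1 hb
  have hz0 : ∀ i ∈ I, z i ≠ 0 := by
    rintro i hi h0
    have := hz i hi
    rw [h0, zero_pow hn.ne'] at this
    exact zero_ne_one this
  -- Dividing by `z i₀` turns its class into the terms killed by the primorial power.
  have h1 := sum_filter_pow_primorial_eq_one k a (fun i => z i / z i₀) n I hn hI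
    (fun i hi => by rw [div_pow, hz i hi, hz i₀ hi₀, div_one])
    (by simp_rw [← mul_div_assoc]; rw [← Finset.sum_div, h, zero_div])
  have h2 : ∑ i ∈ I with z i ^ primorial k = z i₀ ^ primorial k,
      (a i : ℂ) * (z i * t ^ e i) = (z i₀ * t ^ e i₀) *
        ∑ i ∈ I with (z i / z i₀) ^ primorial k = 1, (a i : ℂ) * (z i / z i₀) := by
    have hf : (I.filter fun i => (z i / z i₀) ^ primorial k = 1) =
        I.filter fun i => z i ^ primorial k = z i₀ ^ primorial k := by
      refine Finset.filter_congr fun i _ => ?_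
      rw [div_pow, div_eq_one_iff_eq (pow_ne_zero _ (hz0 i₀ hi₀))]
    rw [hf, Finset.mul_sum]
    refine Finset.sum_congr rfl fun i hi => ?_
    obtain ⟨hi, hii⟩ := Finset.mem_filter.1 hi
    rw [he i hi i₀ hi₀ hii]
    have := hz0 i₀ hi₀
    field_simp
  rw [h2, h1, mul_zero]

theorem prod_zpow_eq_zpow_sum {ι : Type*} {t : ℂ} (ht : t ≠ 0) (S : Finset ι) (m : ι → ℤ) :
    ∏ l ∈ S, t ^ m l = t ^ ∑ l ∈ S, m l := by
  classical
  induction S using Finset.induction_on with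
  | empty => simp
  | insert l S hl ih => rw [Finset.prod_insert hl, Finset.sum_insert hl, zpow_add₀ ht, ih]

theorem exists_ne_zero_zpow_eq {m : ℤ} (hm : m ≠ 0) {w : ℂ} (hw : w ≠ 0) :
    ∃ t : ℂ, t ≠ 0 ∧ t ^ m = w := by
  obtain ⟨k, rfl | rfl⟩ := m.eq_nat_or_neg
  · have hk : 0 < k := by omega
    obtain ⟨t, ht⟩ := IsAlgClosed.exists_pow_nat_eq w hk
    refine ⟨t, ?_, by rw [zpow_natCast, ht]⟩
    rintro rfl
    rw [zero_pow hk.ne'] at ht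
    exact hw ht.symm
  · have hk : 0 < k := by omega
    obtain ⟨t, ht⟩ := IsAlgClosed.exists_pow_nat_eq w⁻¹ hk
    refine ⟨t, ?_, by rw [zpow_neg, zpow_natCast, ht, inv_inv]⟩
    rintro rfl
    rw [zero_pow hk.ne'] at ht
    exact inv_ne_zero hw ht.symm

/-- If the Cayley transforms of at most four roots of unity satisfy a rational linear relation,
then each root of unity that occurs in it has bounded order or satisfies a multiplicative relation
of bounded height with one of the others. -/
theorem bounded_order_or_bounded_relation (T : Finset ℂ) (hT : T.card ≤ 4) (c : ℂ → ℚ)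
    (hroot : ∀ j ∈ T, ∃ n : ℕ, 0 < n ∧ j ^ n = 1) (hne : ∀ j ∈ T, j ≠ 1)
    (hrel : ∑ j ∈ T, (c j : ℂ) * cayley j = 0) {i : ℂ} (hi : i ∈ T) (hc : c i ≠ 0) :
    (∃ q : ℕ, 1 ≤ q ∧ q ≤ 625 ∧ i ^ (primorial 16 * q) = 1) ∨
      ∃ l ∈ T.erase i, ∃ (m : ℕ) (m' : ℤ), 1 ≤ m ∧ m ≤ 625 ∧ |m'| ≤ 625 ∧ i ^ m = l ^ m' := by
  classical
  obtain ⟨n, hn, hzn⟩ : ∃ n : ℕ, 0 < n ∧ ∀ j ∈ T, j ^ n = 1 := by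
    choose! N hN hN1 using hroot
    refine ⟨∏ j ∈ T, N j, Finset.prod_pos hN, fun j hj => ?_⟩
    obtain ⟨d, hd⟩ := Finset.dvd_prod_of_mem N hj
    rw [hd, pow_mul, hN1 j hj, one_pow]
  have hne0 : ∀ j ∈ T, j ≠ 0 := by
    rintro j hj rfl
    have := hzn 0 hj
    rw [zero_pow hn.ne'] at this
    exact zero_ne_one this
  obtain ⟨a, ha⟩ := exists_cayley_numerator_expansion T c
  set M := primorial 16 with hM
  let θ : ℂ → ℝ := fun j => Complex.arg j / (2 * Real.pi)
  have hθ : ∀ j ∈ T, Complex.exp (2 * Real.pi * Complex.I * θ j) = j := by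
    intro j hj
    have hnorm : ‖j‖ = 1 := Complex.norm_eq_one_of_pow_eq_one (hzn j hj) hn.ne'
    have := Complex.norm_mul_exp_arg_mul_I j
    rw [hnorm, Complex.ofReal_one, one_mul] at this
    rw [← this]
    congr 1
    simp only [θ]
    push_cast
    have hpi : (Real.pi : ℂ) ≠ 0 := by exact_mod_cast Real.pi_ne_zero
    rw [this]
    field_simp
  have hint : ∀ r : ℝ, Complex.exp (2 * Real.pi * Complex.I * r) = 1 → ∃ k : ℤ, r = k := by
    intro r hr
    obtain ⟨k, hk⟩ := Complex.exp_eq_one_iff.1 hr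
    refine ⟨k, ?_⟩
    have hpi : (2 * Real.pi * Complex.I : ℂ) ≠ 0 := Complex.two_pi_I_ne_zero
    rw [mul_comm] at hk
    exact_mod_cast mul_right_cancel₀ hpi hk
  let y : ℂ → ℝ := fun j => M * θ j
  let ind : Finset ℂ → ℂ → ℤ := fun S x => if x ∈ S then 1 else 0
  -- Orthogonality to `L` says exactly that an exponent vector has equal sums over `S` and `S'`
  -- whenever their monomials lie in the same class.
  let L : Set (ℂ → ℤ) := {v | ∃ S ⊆ T, ∃ S' ⊆ T,
    (∏ l ∈ S, l) ^ M = (∏ l ∈ S', l) ^ M ∧ v = fun x => ind S x - ind S' x}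
  have hL : ∀ v ∈ L, ∀ x ∈ T, |v x| ≤ 1 := by
    rintro v ⟨S, -, S', -, -, rfl⟩ x -
    simp only [ind]
    split_ifs <;> simp
  have hLy : ∀ v ∈ L, ∃ k : ℤ, ∑ x ∈ T, (v x : ℝ) * y x = k := by
    rintro v ⟨S, hS, S', hS', hSS, rfl⟩
    apply hint
    have hsum : ∀ S ⊆ T, ∑ x ∈ T, (ind S x : ℝ) * y x = ∑ x ∈ S, y x := by
      intro S hS
      simp only [ind]
      push_cast
      simp only [ite_mul, one_mul, zero_mul]
      rw [← Finset.sum_filter, Finset.filter_mem_eq_inter, Finset.inter_eq_right.2 hS]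
    have hexp : ∀ S ⊆ T, Complex.exp (2 * Real.pi * Complex.I * (∑ x ∈ S, y x : ℝ)) =
        (∏ l ∈ S, l) ^ M := by
      intro S hS
      push_cast
      rw [Finset.mul_sum, Complex.exp_sum, ← Finset.prod_pow]
      refine Finset.prod_congr rfl fun x hx => ?_
      rw [← hθ x (hS hx), ← Complex.exp_nat_mul, hθ x (hS hx)]
      simp only [y]
      push_cast
      congr 1
      ring
    push_cast
    simp_rw [sub_mul]
    rw [Finset.sum_sub_distrib]
    have e1 := hsum S hS
    have e2 := hsum S' hS'
    have e3 : ((∑ x ∈ T, ((ind S x : ℂ) * y x) - ∑ x ∈ T, ((ind S' x : ℂ) * y x)) : ℂ) =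
        ((∑ x ∈ S, y x : ℝ) : ℂ) - ((∑ x ∈ S', y x : ℝ) : ℂ) := by
      rw [← e1, ← e2]
      push_cast
      rfl
    rw [e3, mul_sub, Complex.exp_sub, hexp S hS, hexp S' hS', hSS, div_self]
    exact pow_ne_zero _ (Finset.prod_ne_zero_iff.2 fun l hl => hne0 l (hS' hl))
  obtain ⟨q, hq1, hq, hr⟩ := exists_nat_forall_abs_mul_sub_round_lt T y
  have hq625 : q ≤ 625 := hq.trans (Nat.pow_le_pow_right (by norm_num) hT)
  let ε : ℂ → ℝ := fun x => (q : ℝ) * y x - round ((q : ℝ) * y x)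
  by_cases hεi : ε i = 0
  · left
    refine ⟨q, hq1, hq625, ?_⟩
    have h1 : (q : ℝ) * (M * θ i) = round ((q : ℝ) * y i) := sub_eq_zero.1 hεi
    have h2 : (q : ℂ) * (M * θ i) = ((round ((q : ℝ) * y i) : ℤ) : ℂ) := by exact_mod_cast h1
    rw [← hθ i hi, ← Complex.exp_nat_mul, Complex.exp_eq_one_iff]
    refine ⟨round ((q : ℝ) * y i), ?_⟩
    rw [← h2]
    push_cast
    ring
  right
  -- Each `v ∈ L` pairs with `y` to an integer, hence with `ε` to an integer of absolute value below
  -- `1`.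
  have hεL : ∀ v ∈ L, ∑ x ∈ T, (v x : ℝ) * ε x = 0 := by
    intro v hv
    obtain ⟨k, hk⟩ := hLy v hv
    have h1 : ∑ x ∈ T, (v x : ℝ) * ε x =
        ((q * k - ∑ x ∈ T, v x * round ((q : ℝ) * y x) : ℤ) : ℝ) := by
      push_cast
      rw [← hk, Finset.mul_sum, ← Finset.sum_sub_distrib]
      exact Finset.sum_congr rfl fun x _ => by simp only [ε]; ring
    have h2 := abs_sum_mul_lt_one T hT (fun x => (v x : ℝ)) ε
      (fun x hx => by exact_mod_cast hL v hv x hx) hr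
    rw [h1] at h2 ⊢
    have h3 : |q * k - ∑ x ∈ T, v x * round ((q : ℝ) * y x)| < 1 := by exact_mod_cast h2
    rw [Int.abs_lt_one_iff.1 h3, Int.cast_zero]
  obtain ⟨k, hk⟩ : ∃ k : ℕ, 1 ≤ 5 ^ k * |ε i| := by
    obtain ⟨k, hk⟩ := pow_unbounded_of_one_lt (|ε i|)⁻¹ (by norm_num : (1 : ℝ) < 5)
    refine ⟨k, ?_⟩
    have := abs_pos.2 hεi
    rw [inv_lt_iff_one_lt_mul₀ this] at hk
    linarith
  obtain ⟨m, hmi, hm, hmL⟩ := exists_int_orthogonal_of_real T hT L hL hi k ε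
    (fun x hx => by have := hr x hx; simp only [ε]; linarith) hk hεL
  have hdeform : ∀ t : ℂ, t ≠ 0 → ∑ j ∈ T, (c j : ℂ) *
      ((1 + j * t ^ m j) * ∏ l ∈ T.erase j, (1 - l * t ^ m l)) = 0 := by
    intro t ht
    rw [ha fun j => j * t ^ m j]
    have h0 : ∑ S ∈ T.powerset, (a S : ℂ) * ∏ l ∈ S, l = 0 := by
      rw [← ha fun j => j, cayley_numerator_eq T c _ hne, hrel, mul_zero]
    have hcard : T.powerset.card ≤ 16 := by
      rw [Finset.card_powerset]
      exact Nat.pow_le_pow_right (by norm_num) hT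
    rw [← sum_mul_zpow_eq_zero 16 T.powerset hcard a (fun S => ∏ l ∈ S, l) hn
      (fun S hS => by
        rw [← Finset.prod_pow]
        exact Finset.prod_eq_one fun l hl => hzn l (Finset.mem_powerset.1 hS hl))
      h0 (fun S => ∑ l ∈ S, m l) ?_ t]
    · refine Finset.sum_congr rfl fun S _ => ?_
      rw [Finset.prod_mul_distrib, prod_zpow_eq_zpow_sum ht]
    · intro S hS S' hS' hSS
      rw [Finset.mem_powerset] at hS hS'
      have h1 := hmL _ ⟨S, hS, S', hS', hSS, rfl⟩
      have hsum : ∀ S ⊆ T, ∑ x ∈ T, ind S x * m x = ∑ x ∈ S, m x := by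
        intro S hS
        simp only [ind, ite_mul, one_mul, zero_mul]
        rw [← Finset.sum_filter, Finset.filter_mem_eq_inter, Finset.inter_eq_right.2 hS]
      simp_rw [sub_mul] at h1
      rw [Finset.sum_sub_distrib, hsum S hS, hsum S' hS'] at h1
      exact sub_eq_zero.1 h1
  -- This `t` moves `i` to `1`. Every summand with `j ≠ i` contains `1 - i * t ^ m i = 0`, and the
  -- remaining one is `2 * c i` times the product over the other roots.
  obtain ⟨t, ht0, ht⟩ := exists_ne_zero_zpow_eq hmi (inv_ne_zero (hne0 i hi))
  have hxi : i * t ^ m i = 1 := by rw [ht, mul_inv_cancel₀ (hne0 i hi)]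
  have h1 := hdeform t ht0
  rw [Finset.sum_eq_single_of_mem i hi, hxi] at h1
  swap
  · intro j hj hji
    rw [Finset.prod_eq_zero (Finset.mem_erase.2 ⟨hji.symm, hi⟩) (by rw [hxi, sub_self])]
    simp
  have h2 : ∏ l ∈ T.erase i, (1 - l * t ^ m l) = 0 := by
    have hc' : (c i : ℂ) ≠ 0 := by exact_mod_cast hc
    rcases mul_eq_zero.1 h1 with h | h
    · exact absurd h hc'
    · exact (mul_eq_zero.1 h).resolve_left (by norm_num)
  obtain ⟨l, hl, hl0⟩ := Finset.prod_eq_zero_iff.1 h2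
  have hxl : l * t ^ m l = 1 := (sub_eq_zero.1 hl0).symm
  have hlT := Finset.mem_of_mem_erase hl
  have hml : m l ≠ 0 := by
    intro h
    rw [h, zpow_zero, mul_one] at hxl
    exact hne l hlT hxl
  have hi' : i = t ^ (-m i) := by rw [zpow_neg]; exact eq_inv_of_mul_eq_one_left hxi
  have hl' : l = t ^ (-m l) := by rw [zpow_neg]; exact eq_inv_of_mul_eq_one_left hxl
  have hrel' : i ^ m l = l ^ m i := by
    rw [hi', hl', ← zpow_mul, ← zpow_mul, ← hi', ← hl']
    congr 1
    ring
  -- The relation `i ^ m l = l ^ m i` is inverted if necessary to make the exponent of `i` positive.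
  refine ⟨l, hl, (m l).natAbs, if 0 ≤ m l then m i else -m i, by omega,
    by have := abs_le.1 (hm l hlT); omega, ?_, ?_⟩
  · split_ifs
    · exact hm i hi
    · rw [abs_neg]
      exact hm i hi
  · rw [← zpow_natCast]
    split_ifs with h
    · rw [Int.natAbs_of_nonneg h, hrel']
    · rw [Int.ofNat_natAbs_of_nonpos (by omega), zpow_neg, zpow_neg, hrel']

/-! ### Counting roots of unity. -/

/-- The count below stays under `1.4 * 10 ^ 10`, so this crude bound suffices. -/
theorem twenty_billion_le_N₀ : 20000000000 ≤ N₀ := by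
  have : (Finset.Icc 7 37).filter Nat.Prime = {7, 11, 13, 17, 19, 23, 29, 31, 37} := by
    decide +kernel
  rw [N₀, this]
  norm_num

/-- The roots of unity `≠ 1` whose Cayley transforms lie in a fixed rational vector space of
dimension at most `3` are at most `N₀` in number. -/
theorem card_le_N₀_of_cayley_mem (W : Submodule ℚ ℂ) [FiniteDimensional ℚ W]
    (hW : Module.finrank ℚ W ≤ 3) (F : Finset ℂ) (hroot : ∀ j ∈ F, ∃ n : ℕ, 0 < n ∧ j ^ n = 1)
    (hne : ∀ j ∈ F, j ≠ 1) (hF : ∀ j ∈ F, cayley j ∈ W) : F.card ≤ N₀ := by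
  classical
  obtain ⟨b, hbF, -, hspan, hlin⟩ := exists_linearIndepOn_extension
    (linearIndepOn_empty ℚ cayley) (Set.empty_subset (F : Set ℂ))
  lift b to Finset ℂ using F.finite_toSet.subset hbF
  have hbF' : b ⊆ F := by exact_mod_cast hbF
  have hb3 : b.card ≤ 3 := by
    refine le_trans ?_ hW
    have h1 : LinearIndependent ℚ fun x : b => (⟨cayley x, hF x (hbF' x.2)⟩ : W) := by
      refine LinearIndependent.of_comp W.subtype ?_
      exact hlin
    have h2 := h1.fintype_card_le_finrank
    simpa using h2
  -- `b` indexes a basis of the span of the transforms. `A` collects the roots of bounded order, `B`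
  -- those with a bounded relation to an element of `b`.
  let A : Finset ℂ := (Finset.Icc 1 625).biUnion fun q =>
    (Polynomial.nthRoots (primorial 16 * q) (1 : ℂ)).toFinset
  let B : Finset ℂ := b.biUnion fun l => (Finset.Icc 1 625).biUnion fun m =>
    (Finset.Icc (-625 : ℤ) 625).biUnion fun m' => (Polynomial.nthRoots m (l ^ m')).toFinset
  have hcover : F ⊆ b ∪ (A ∪ B) := by
    intro i hi
    rw [Finset.mem_union, Finset.mem_union, or_iff_not_imp_left]
    intro hib
    have hmem := hspan (Set.mem_image_of_mem cayley (Finset.mem_coe.2 hi))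
    rw [SetLike.mem_coe, Submodule.mem_span_image_finset_iff_exists_fun'] at hmem
    obtain ⟨d, hd⟩ := hmem
    let c : ℂ → ℚ := fun j => if j = i then -1 else d j
    have hTF : insert i b ⊆ F := Finset.insert_subset hi hbF'
    have hrel : ∑ j ∈ insert i b, (c j : ℂ) * cayley j = 0 := by
      have h1 : ∑ j ∈ b, (c j : ℂ) * cayley j = cayley i := by
        rw [← hd]
        refine Finset.sum_congr rfl fun j hj => ?_
        have hji : j ≠ i := fun h => hib (h ▸ hj)
        rw [Rat.smul_def]
        simp only [c, if_neg hji]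
      rw [Finset.sum_insert hib, h1]
      simp [c]
    have hmain := bounded_order_or_bounded_relation (insert i b)
      ((Finset.card_insert_le _ _).trans (by omega)) c (fun j hj => hroot j (hTF hj))
      (fun j hj => hne j (hTF hj)) hrel (Finset.mem_insert_self i b) (by simp [c])
    rw [Finset.erase_insert hib] at hmain
    rcases hmain with ⟨q, hq1, hq, h⟩ | ⟨l, hl, m, m', hm1, hm, hm', h⟩
    · left
      refine Finset.mem_biUnion.2 ⟨q, Finset.mem_Icc.2 ⟨hq1, hq⟩, ?_⟩
      rw [Multiset.mem_toFinset, Polynomial.mem_nthRoots]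
      · exact h
      · exact Nat.mul_pos (primorial_pos 16) hq1
    · right
      simp only [B, Finset.mem_biUnion, Finset.mem_Icc]
      refine ⟨l, hl, m, ⟨hm1, hm⟩, m', abs_le.1 hm', ?_⟩
      rw [Multiset.mem_toFinset, Polynomial.mem_nthRoots (by omega)]
      exact h
  have hroots : ∀ (n : ℕ) (w : ℂ), (Polynomial.nthRoots n w).toFinset.card ≤ n := fun n w =>
    (Multiset.toFinset_card_le _).trans (Polynomial.card_nthRoots n w)
  have hprim : primorial 16 = 30030 := by decide +kernel
  have hA : A.card ≤ 625 * (30030 * 625) := by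
    have h1 := Finset.card_biUnion_le_card_mul (Finset.Icc 1 625)
      (fun q => (Polynomial.nthRoots (primorial 16 * q) (1 : ℂ)).toFinset) (30030 * 625)
      fun q hq => (hroots _ _).trans (by
        rw [hprim]
        exact Nat.mul_le_mul_left _ (Finset.mem_Icc.1 hq).2)
    rwa [Nat.card_Icc] at h1
  have hB : B.card ≤ 3 * (625 * (1251 * 625)) := by
    refine (Finset.card_biUnion_le_card_mul _ _ (625 * (1251 * 625)) fun l _ => ?_).trans
      (Nat.mul_le_mul_right _ hb3)
    have h1 := Finset.card_biUnion_le_card_mul (Finset.Icc 1 625)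
      (fun m => (Finset.Icc (-625 : ℤ) 625).biUnion fun m' =>
        (Polynomial.nthRoots m (l ^ m')).toFinset) (1251 * 625) fun m hm => by
        have h2 := Finset.card_biUnion_le_card_mul (Finset.Icc (-625 : ℤ) 625)
          (fun m' => (Polynomial.nthRoots m (l ^ m')).toFinset) 625
          fun m' _ => (hroots _ _).trans (Finset.mem_Icc.1 hm).2
        simpa using h2
    rwa [Nat.card_Icc] at h1
  have h1 := Finset.card_le_card hcover
  have h2 := Finset.card_union_le b (A ∪ B)
  have h3 := Finset.card_union_le A B
  have h4 := twenty_billion_le_N₀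
  omega

/-! ### Double angles in a space. -/

open ComplexConjugate in
/-- The unit complex number `exp (2 i β)`, where `β` is the angle from `v` to `u`. -/
noncomputable def doubleAngle (v u : ℂ) : ℂ := u * conj v / (conj u * v)

theorem exists_pow_doubleAngle_eq_one {v u : ℂ} (h : FormsRationalAngle v u) :
    ∃ n : ℕ, 0 < n ∧ doubleAngle v u ^ n = 1 := by
  obtain ⟨hv, hu, -, q, hq⟩ := h
  have hz : u / v ≠ 0 := div_ne_zero hu hv
  have hnorm : ((‖u / v‖ : ℝ) : ℂ) ≠ 0 := by exact_mod_cast norm_ne_zero_iff.2 hz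
  have h1 := Complex.norm_mul_exp_arg_mul_I (u / v)
  have h2 : doubleAngle v u = (u / v) / (starRingEnd ℂ) (u / v) := by
    rw [doubleAngle, map_div₀]
    have := (map_ne_zero (starRingEnd ℂ)).2 hv
    have := (map_ne_zero (starRingEnd ℂ)).2 hu
    field_simp
  have h3 : doubleAngle v u = Complex.exp (2 * (Complex.arg (u / v) * Complex.I)) := by
    rw [h2]
    conv_lhs => rw [← h1]
    rw [map_mul, Complex.conj_ofReal, ← Complex.exp_conj, map_mul, Complex.conj_ofReal,
      Complex.conj_I, mul_div_mul_left _ _ hnorm, ← Complex.exp_sub]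
    congr 1
    ring
  refine ⟨q.den, q.den_pos, ?_⟩
  rw [h3, ← Complex.exp_nat_mul, Complex.exp_eq_one_iff]
  refine ⟨q.num, ?_⟩
  have h4 : (q.den : ℂ) * (q : ℂ) = q.num := by
    exact_mod_cast Rat.den_mul_eq_num q
  rw [hq, ← h4]
  push_cast
  ring

theorem doubleAngle_ne_one {v u : ℂ} (h : FormsRationalAngle v u) : doubleAngle v u ≠ 1 := by
  obtain ⟨hv, hu, hr, -⟩ := h
  have hv' := (map_ne_zero (starRingEnd ℂ)).2 hv
  have hu' := (map_ne_zero (starRingEnd ℂ)).2 hu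
  intro h1
  rw [doubleAngle, div_eq_one_iff_eq (mul_ne_zero hu' hv)] at h1
  apply hr
  obtain ⟨r, hr⟩ := Complex.conj_eq_iff_real.1 (show (starRingEnd ℂ) (u / v) = u / v by
    rw [map_div₀, div_eq_div_iff hv' hv, h1])
  exact ⟨r, hr.symm⟩

theorem linearIndependent_pair_of_div_notMem {v u : ℂ} (hv : v ≠ 0)
    (h : u / v ∉ Set.range ((↑) : ℝ → ℂ)) : LinearIndependent ℝ ![v, u] := by
  rw [LinearIndependent.pair_iff]
  intro s t hst
  rw [Complex.real_smul, Complex.real_smul] at hst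
  have ht : t = 0 := by
    by_contra ht
    have ht' : (t : ℂ) ≠ 0 := by exact_mod_cast ht
    apply h
    refine ⟨-s / t, ?_⟩
    push_cast
    rw [div_eq_div_iff ht' hv]
    linear_combination -hst
  subst ht
  refine ⟨?_, rfl⟩
  simpa [hv] using hst

/-- Two `ℝ`-independent vectors of a space span it over `ℚ`. -/
theorem exists_rat_combination {V : Submodule ℚ ℂ} (hV : Module.finrank ℚ V = 2) {v w : ℂ}
    (hv : v ∈ V) (hw : w ∈ V) (hvw : LinearIndependent ℝ ![v, w]) {u : ℂ} (hu : u ∈ V) :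
    ∃ a b : ℚ, u = a * v + b * w := by
  have hli : LinearIndependent ℚ ![(⟨v, hv⟩ : V), ⟨w, hw⟩] := by
    rw [LinearIndependent.pair_iff] at hvw ⊢
    intro s t hst
    have h1 := congrArg Subtype.val hst
    simp only [Submodule.coe_add, Submodule.coe_smul, ZeroMemClass.coe_zero, Rat.smul_def] at h1
    have h2 := hvw s t (by
      rw [Complex.real_smul, Complex.real_smul]
      exact_mod_cast h1)
    exact ⟨by exact_mod_cast h2.1, by exact_mod_cast h2.2⟩
  have : Module.Finite ℚ V := Module.finite_of_finrank_pos (by omega)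
  have hspan := hli.span_eq_top_of_card_eq_finrank' (by rw [hV]; simp)
  have hmem : (⟨u, hu⟩ : V) ∈ Submodule.span ℚ (Set.range ![(⟨v, hv⟩ : V), ⟨w, hw⟩]) := by
    rw [hspan]
    trivial
  rw [Matrix.range_cons, Matrix.range_cons, Matrix.range_empty, Set.union_empty,
    Set.singleton_union, Submodule.mem_span_pair] at hmem
  obtain ⟨a, b, hab⟩ := hmem
  have h1 := congrArg Subtype.val hab
  simp only [Submodule.coe_add, Submodule.coe_smul, Rat.smul_def] at h1
  exact ⟨a, b, h1.symm⟩

/-- The Cayley transforms of the double angles between vectors of a space lie in a rational vector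
space of dimension at most three. -/
theorem exists_submodule_cayley_doubleAngle_mem {V : Submodule ℚ ℂ} (hV : IsSpace V) :
    ∃ W : Submodule ℚ ℂ, FiniteDimensional ℚ W ∧ Module.finrank ℚ W ≤ 3 ∧
      ∀ v ∈ V, ∀ u ∈ V, FormsRationalAngle v u → cayley (doubleAngle v u) ∈ W := by
  classical
  obtain ⟨hdim, e, he, f, hf, hef⟩ := hV
  let G : ℂ := e * (starRingEnd ℂ) f - f * (starRingEnd ℂ) e
  let s : Finset ℂ := {e * (starRingEnd ℂ) e / G, f * (starRingEnd ℂ) f / G,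
    (e * (starRingEnd ℂ) f + f * (starRingEnd ℂ) e) / G}
  refine ⟨Submodule.span ℚ s, FiniteDimensional.span_finset ℚ s,
    (finrank_span_finset_le_card s).trans Finset.card_le_three, ?_⟩
  intro v hv u hu h
  have hne := doubleAngle_ne_one h
  have hv' := (map_ne_zero (starRingEnd ℂ)).2 h.1
  have hu' := (map_ne_zero (starRingEnd ℂ)).2 h.2.1
  obtain ⟨a, b, hab⟩ := exists_rat_combination hdim he hf hef hv
  obtain ⟨a', b', hab'⟩ := exists_rat_combination hdim he hf hef hu
  have hD : (starRingEnd ℂ) u * v ≠ 0 := mul_ne_zero hu' h.1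
  -- The denominator is alternating in `(v, u)`, so it is a rational multiple of the single number
  -- `G`; the numerator is symmetric, which leaves three generators.
  have hDN : (starRingEnd ℂ) u * v - u * (starRingEnd ℂ) v = ((a : ℂ) * b' - b * a') * G := by
    simp only [hab, hab', map_add, map_mul, map_ratCast, G]
    ring
  have hDN0 : ((a : ℂ) * b' - b * a') * G ≠ 0 := by
    rw [← hDN, sub_ne_zero]
    intro h0
    apply hne
    rw [doubleAngle, ← h0, div_self hD]
  have hΔ := left_ne_zero_of_mul hDN0
  have hG := right_ne_zero_of_mul hDN0
  have hmem : ∀ x ∈ s, x ∈ Submodule.span ℚ (s : Set ℂ) := fun x hx =>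
    Submodule.subset_span hx
  have hcay : cayley (doubleAngle v u) =
      (2 * a * a' / (a * b' - b * a') : ℚ) • (e * (starRingEnd ℂ) e / G) +
      (2 * b * b' / (a * b' - b * a') : ℚ) • (f * (starRingEnd ℂ) f / G) +
      ((a * b' + b * a') / (a * b' - b * a') : ℚ) •
        ((e * (starRingEnd ℂ) f + f * (starRingEnd ℂ) e) / G) := by
    have h1 : cayley (doubleAngle v u) = ((starRingEnd ℂ) u * v + u * (starRingEnd ℂ) v) /
        ((starRingEnd ℂ) u * v - u * (starRingEnd ℂ) v) := by
      rw [cayley, doubleAngle, one_add_div hD, one_sub_div hD, div_div_div_cancel_right₀ hD]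
    rw [h1, hDN, Rat.smul_def, Rat.smul_def, Rat.smul_def]
    push_cast
    have h2 : (starRingEnd ℂ) u * v + u * (starRingEnd ℂ) v =
        2 * a * a' * (e * (starRingEnd ℂ) e) + 2 * b * b' * (f * (starRingEnd ℂ) f) +
          (a * b' + b * a') * (e * (starRingEnd ℂ) f + f * (starRingEnd ℂ) e) := by
      simp only [hab, hab', map_add, map_mul, map_ratCast]
      ring
    rw [h2, div_mul_div_comm, div_mul_div_comm, div_mul_div_comm, ← add_div, ← add_div]
  rw [hcay]
  exact add_mem (add_mem (Submodule.smul_mem _ _ (hmem _ (by simp [s])))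
    (Submodule.smul_mem _ _ (hmem _ (by simp [s])))) (Submodule.smul_mem _ _ (hmem _ (by simp [s])))

/-! ### Angles with a common double angle. -/

/-- A space with three lines that are sent to rational lines by the same rotation has complex
multiplication. -/
theorem hasCM_of_three_rotations {V : Submodule ℚ ℂ} (hV : Module.finrank ℚ V = 2)
    {v₁ v₂ v₃ l : ℂ} {r s : ℝ} (h₁ : v₁ ∈ V) (h₂ : v₂ ∈ V) (h₃ : v₃ ∈ V)
    (h₁₂ : LinearIndependent ℝ ![v₁, v₂]) (h₁₃ : LinearIndependent ℝ ![v₁, v₃])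
    (h₂₃ : LinearIndependent ℝ ![v₂, v₃]) (hl : l ∉ Set.range ((↑) : ℝ → ℂ))
    (hr : r ≠ 0) (hs : s ≠ 0)
    (hl₁ : l * v₁ ∈ V) (hl₂ : l * r * v₂ ∈ V) (hl₃ : l * s * v₃ ∈ V) : HasCM V := by
  have hl0 : l ≠ 0 := by
    rintro rfl
    exact hl ⟨0, by simp⟩
  obtain ⟨a, b, hab⟩ := exists_rat_combination hV h₁ h₂ h₁₂ h₃
  have hind : LinearIndependent ℝ ![l * v₁, l * r * v₂] := by
    rw [LinearIndependent.pair_iff] at h₁₂ ⊢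
    intro x y hxy
    simp only [Complex.real_smul] at hxy h₁₂
    have := h₁₂ x (y * r) (mul_left_cancel₀ hl0 (by push_cast; linear_combination hxy))
    exact ⟨this.1, (mul_eq_zero.1 this.2).resolve_right hr⟩
  obtain ⟨c, d, hcd⟩ := exists_rat_combination hV hl₁ hl₂ hind hl₃
  rw [LinearIndependent.pair_iff] at h₁₂ h₁₃ h₂₃
  simp only [Complex.real_smul] at h₁₂ h₁₃ h₂₃
  have ha : (a : ℝ) ≠ 0 := by
    intro h0
    have h0' : (a : ℂ) = 0 := by exact_mod_cast h0
    have := (h₂₃ b (-1) (by rw [hab, h0']; push_cast; ring)).2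
    norm_num at this
  have hb : (b : ℝ) ≠ 0 := by
    intro h0
    have h0' : (b : ℂ) = 0 := by exact_mod_cast h0
    have := (h₁₃ a (-1) (by rw [hab, h0']; push_cast; ring)).2
    norm_num at this
  -- Expanding `l * s * v₃` through `v₃ = a v₁ + b v₂` and in the basis `l * v₁`, `l * r * v₂` gives
  -- `s * a = c` and `s * b = d * r`. So `r` is rational, `l * v₂ ∈ V`, and `l` itself preserves
  -- `V`.
  have hcoef := h₁₂ (s * a - c) (s * b - d * r) (mul_left_cancel₀ hl0 (by
    rw [hab] at hcd
    push_cast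
    linear_combination hcd))
  have hsa : s * a = c := sub_eq_zero.1 hcoef.1
  have hsb : s * b = d * r := sub_eq_zero.1 hcoef.2
  have hd : (d : ℝ) ≠ 0 := by
    intro h0
    rw [h0, zero_mul] at hsb
    exact mul_ne_zero hs hb hsb
  have hc : (c : ℝ) ≠ 0 := hsa ▸ mul_ne_zero hs ha
  have hr_rat : r = ((c * b / (a * d) : ℚ) : ℝ) := by
    push_cast
    rw [eq_div_iff (mul_ne_zero ha hd), ← hsa]
    linear_combination -a * hsb
  set ρ : ℚ := c * b / (a * d)
  have hρ : (ρ : ℂ) ≠ 0 := by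
    rw [hr_rat] at hr
    exact_mod_cast hr
  have hl₂' : l * v₂ ∈ V := by
    have h1 : l * v₂ = (ρ⁻¹ : ℚ) • (l * r * v₂) := by
      rw [Rat.smul_def, hr_rat]
      push_cast
      field_simp
    rw [h1]
    exact V.smul_mem _ hl₂
  refine ⟨l, ?_, fun u hu => ?_⟩
  · rintro ⟨q, hq⟩
    exact hl ⟨q, by rw [← hq]; simp⟩
  · obtain ⟨x, y, hxy⟩ := exists_rat_combination hV h₁ h₂
      (by rw [LinearIndependent.pair_iff]; simpa only [Complex.real_smul] using h₁₂) hu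
    have h1 : l * u = x • (l * v₁) + y • (l * v₂) := by
      rw [hxy, Rat.smul_def, Rat.smul_def]
      ring
    rw [h1]
    exact V.add_mem (V.smul_mem _ hl₁) (V.smul_mem _ hl₂')

/-- The double angle is `z / conj z` for `z = u / v`, which determines `z` up to a real factor. -/
theorem exists_real_mul_eq_of_doubleAngle_eq {v u v' u' : ℂ} (h : FormsRationalAngle v u)
    (h' : FormsRationalAngle v' u') (heq : doubleAngle v u = doubleAngle v' u') :
    ∃ r : ℝ, r ≠ 0 ∧ u' = u / v * r * v' := by
  obtain ⟨hv, hu, -⟩ := h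
  obtain ⟨hv', hu', -⟩ := h'
  have cv := (map_ne_zero (starRingEnd ℂ)).2 hv
  have cu := (map_ne_zero (starRingEnd ℂ)).2 hu
  have cv' := (map_ne_zero (starRingEnd ℂ)).2 hv'
  have cu' := (map_ne_zero (starRingEnd ℂ)).2 hu'
  rw [doubleAngle, doubleAngle, div_eq_div_iff (mul_ne_zero cu hv) (mul_ne_zero cu' hv')] at heq
  obtain ⟨r, hr⟩ := Complex.conj_eq_iff_real.1
    (show (starRingEnd ℂ) (u' * v / (u * v')) = u' * v / (u * v') by
      simp only [map_div₀, map_mul]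
      rw [div_eq_div_iff (mul_ne_zero cu cv') (mul_ne_zero hu hv')]
      linear_combination heq)
  refine ⟨r, ?_, ?_⟩
  · rintro rfl
    rw [Complex.ofReal_zero] at hr
    exact div_ne_zero (mul_ne_zero hu' hv) (mul_ne_zero hu hv') hr
  · rw [← hr]
    field_simp

/-- The first line and the double angle determine the second line, so distinct angles with the same
double angle have distinct first lines. -/
theorem linearIndependent_of_span_pair_ne {v u v' u' : ℂ} (h : FormsRationalAngle v u)
    (h' : FormsRationalAngle v' u') (heq : doubleAngle v u = doubleAngle v' u')
    (hne : (Submodule.span ℝ {v}, Submodule.span ℝ {u}) ≠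
      (Submodule.span ℝ {v'}, Submodule.span ℝ {u'})) : LinearIndependent ℝ ![v, v'] := by
  refine linearIndependent_pair_of_div_notMem h.1 ?_
  rintro ⟨t, ht⟩
  apply hne
  obtain ⟨r, hr, hu'⟩ := exists_real_mul_eq_of_doubleAngle_eq h h' heq
  have hv0 := h.1
  have hv'0 := h'.1
  have ht0 : t ≠ 0 := by
    rintro rfl
    rw [Complex.ofReal_zero] at ht
    exact div_ne_zero hv'0 hv0 ht.symm
  have hv' : v' = t • v := by
    rw [Complex.real_smul, ht]
    field_simp
  have hu'' : u' = (r * t) • u := by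
    rw [hu', hv', Complex.real_smul, Complex.real_smul]
    push_cast
    field_simp
  rw [hv', hu'', Submodule.span_singleton_smul_eq (IsUnit.mk0 t ht0),
    Submodule.span_singleton_smul_eq (IsUnit.mk0 (r * t) (mul_ne_zero hr ht0))]

theorem card_le_of_subset_rationalAngles {V : Submodule ℚ ℂ} (hV : IsSpace V) (hCM : ¬ HasCM V)
    (F : Finset (Submodule ℝ ℂ × Submodule ℝ ℂ))
    (hF : (F : Set (Submodule ℝ ℂ × Submodule ℝ ℂ)) ⊆ rationalAngles V) : F.card ≤ 2 * N₀ := by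
  classical
  obtain ⟨W, hWfin, hW, hmem⟩ := exists_submodule_cayley_doubleAngle_mem hV
  have hF' : ∀ L ∈ F, ∃ v u : ℂ, v ∈ V ∧ u ∈ V ∧ FormsRationalAngle v u ∧
      L = (Submodule.span ℝ {v}, Submodule.span ℝ {u}) := by
    intro L hL
    obtain ⟨v, hv, u, hu, h, hLeq⟩ := hF hL
    exact ⟨v, u, hv, hu, h, hLeq⟩
  choose! v u hv hu h hL using hF'
  let f := fun L => doubleAngle (v L) (u L)
  refine (Finset.card_le_mul_card_image (f := f) F 2 fun x _ => ?_).trans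
    -- The factor `2` bounds the fibres of the double angle: three angles in one fibre would give
    -- complex multiplication.
    (Nat.mul_le_mul_left 2 (card_le_N₀_of_cayley_mem W hW (F.image f) ?_ ?_ ?_))
  · by_contra hcard
    rw [not_le, Finset.two_lt_card] at hcard
    obtain ⟨L₁, h₁, L₂, h₂, L₃, h₃, h₁₂, h₁₃, h₂₃⟩ := hcard
    rw [Finset.mem_filter] at h₁ h₂ h₃
    obtain ⟨m₁, e₁⟩ := h₁
    obtain ⟨m₂, e₂⟩ := h₂
    obtain ⟨m₃, e₃⟩ := h₃
    have hind : ∀ L ∈ F, ∀ L' ∈ F, f L = f L' → L ≠ L' →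
        LinearIndependent ℝ ![v L, v L'] := by
      intro L m L' m' e hne
      refine linearIndependent_of_span_pair_ne (h L m) (h L' m') e ?_
      rwa [← hL L m, ← hL L' m']
    obtain ⟨r, hr, hr'⟩ := exists_real_mul_eq_of_doubleAngle_eq (h L₁ m₁) (h L₂ m₂)
      (e₁.trans e₂.symm)
    obtain ⟨s, hs, hs'⟩ := exists_real_mul_eq_of_doubleAngle_eq (h L₁ m₁) (h L₃ m₃)
      (e₁.trans e₃.symm)
    refine hCM (hasCM_of_three_rotations hV.1 (hv L₁ m₁) (hv L₂ m₂) (hv L₃ m₃)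
      (hind _ m₁ _ m₂ (e₁.trans e₂.symm) h₁₂) (hind _ m₁ _ m₃ (e₁.trans e₃.symm) h₁₃)
      (hind _ m₂ _ m₃ (e₂.trans e₃.symm) h₂₃) (h L₁ m₁).2.2.1 hr hs ?_ ?_ ?_)
    · rw [div_mul_cancel₀ _ (h L₁ m₁).1]
      exact hu L₁ m₁
    · rw [← hr']
      exact hu L₂ m₂
    · rw [← hs']
      exact hu L₃ m₃
  · intro j hj
    obtain ⟨L, m, rfl⟩ := Finset.mem_image.1 hj
    exact exists_pow_doubleAngle_eq_one (h L m)
  · intro j hj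
    obtain ⟨L, m, rfl⟩ := Finset.mem_image.1 hj
    exact doubleAngle_ne_one (h L m)
  · intro j hj
    obtain ⟨L, m, rfl⟩ := Finset.mem_image.1 hj
    exact hmem _ (hv L m) _ (hu L m) (h L m)

theorem theorem6p1 (V : Submodule ℚ ℂ) (hV : IsSpace V) (hCM : ¬ HasCM V) :
    (rationalAngles V).Finite ∧ (rationalAngles V).ncard ≤ 2 * N₀ + 4 := by
  have hfin : (rationalAngles V).Finite := by
    by_contra hinf
    -- The bound `2 * N₀` is uniform over finite subsets, so it yields finiteness as well; the
    -- summand `4` is slack.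
    obtain ⟨F, hF, hcard⟩ := Set.Infinite.exists_subset_card_eq hinf (2 * N₀ + 1)
    have := card_le_of_subset_rationalAngles hV hCM F hF
    omega
  refine ⟨hfin, ?_⟩
  have := card_le_of_subset_rationalAngles hV hCM hfin.toFinset (by simp)
  rw [Set.ncard_eq_toFinset_card _ hfin]
  omega
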